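/- Let $n$ be a positive integer and let $k\in\{0,1,\dots,n\}$. Let $Q_{n,k}\subset\mathbb{R}^n$ be the polytope defined by the inequalities $x_i\ge 0$ for $1\le i\le n$, $x_i\le 1$ for $1\le i\le k$, and $x_1+x_2+\cdots+x_n\le n$. For a lattice polytope $Q\subset\mathbb{R}^n_{\ge 0}$ of dimension $d$, let $\mathrm{Ehr}(Q,t)$ be its Ehrhart polynomial, that is, the unique polynomial with $\mathrm{Ehr}(Q,m)=\#(mQ\cap\mathbb{N}^n)$ for every $m\in\mathbb{N}=\{0,1,2,\dots\}$, and let the $h^*$-polynomial $h^*(Q,t)$ be defined by the identity of formal power series $$\sum_{m\ge 0}\mathrm{Ehr}(Q,m)\,t^m=\frac{h^*(Q,t)}{(1-t)^{d+1}}.$$ For a word $w=(w_1,w_2,\dots,w_n)\in[n]^n$, where $[n]=\{1,2,\dots,n\}$, let $\mathrm{des}(w)$ be the number of indices $i\in\{1,\dots,n-1\}$ with $w_i>w_{i+1}$, and let $W_{n,k}$ be the set of words $w\in[n]^n$ in which each of $1,2,\dots,k$ appears at least once. Then $$h^*(Q_{n,k},t)=\sum_{w\in W_{n,k}}t^{\,n-1-\mathrm{des}(w)}.$$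 In particular, the polynomial on the right-hand side has only real roots. -/

import Mathlib

open scoped Pointwise

/-- The polytope `Q_{n,k}` in `ℝⁿ`: `x_i ≥ 0` for all `i`, `x_i ≤ 1` for the first `k` coordinates,
and `x_1 + ⋯ + x_n ≤ n`. Coordinates are indexed by `Fin n`, so the first `k` coordinates are the
`i` with `(i : ℕ) < k`. -/
def octopusPolytope (n k : ℕ) : Set (Fin n → ℝ) :=
  {x | (∀ i, 0 ≤ x i) ∧ (∀ i : Fin n, (i : ℕ) < k → x i ≤ 1) ∧ ∑ i, x i ≤ (n : ℝ)}

/-- The points of `P ∩ ℕⁿ`. -/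
def natPoints {n : ℕ} (P : Set (Fin n → ℝ)) : Set (Fin n → ℕ) :=
  {x | (fun i => (x i : ℝ)) ∈ P}

/-- The dimension of a polytope: the dimension of its affine span. -/
noncomputable def polytopeDim {n : ℕ} (P : Set (Fin n → ℝ)) : ℕ :=
  Module.finrank ℝ (vectorSpan ℝ P)

/-- `E` is the Ehrhart polynomial of the polytope `P ⊆ ℝ_{≥0}ⁿ`: `E(m) = #(mP ∩ ℕⁿ)` for every
natural number `m`. -/
def IsEhrhartPolynomial {n : ℕ} (P : Set (Fin n → ℝ)) (E : Polynomial ℝ) : Prop :=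
  ∀ m : ℕ, E.eval (m : ℝ) = ((natPoints ((m : ℝ) • P)).ncard : ℝ)

/-- `h` is the `h^*`-polynomial of the polytope `P ⊆ ℝ_{≥0}ⁿ`: with `E` the Ehrhart polynomial and
`d` the dimension of `P`, one has `∑_{m ≥ 0} E(m) t^m = h(t) / (1 - t)^{d+1}` as formal power
series. -/
def IsHStarPolynomial {n : ℕ} (P : Set (Fin n → ℝ)) (h : Polynomial ℝ) : Prop :=
  ∃ E : Polynomial ℝ, IsEhrhartPolynomial P E ∧
    PowerSeries.mk (fun m : ℕ => E.eval (m : ℝ)) * (1 - PowerSeries.X) ^ (polytopeDim P + 1)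
      = (h : PowerSeries ℝ)

/-- The number of descents of a word `w` of length `n` with letters in `[n]`: the number of
positions `i` that have a next position `i + 1` and satisfy `w_i > w_{i+1}`. -/
def wordDes {n : ℕ} (w : Fin n → Fin n) : ℕ :=
  (Finset.univ.filter fun i : Fin n =>
    ∃ hi : (i : ℕ) + 1 < n, w ⟨(i : ℕ) + 1, hi⟩ < w i).card

/-- The words of length `n` with letters in `[n]` in which each of the `k` smallest letters appears
at least once. The letter `j ∈ {1, …, n}` is represented by the element `j - 1` of `Fin n`. -/
def coveringWords (n k : ℕ) : Finset (Fin n → Fin n) :=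
  Finset.univ.filter fun w => ∀ j : Fin n, (j : ℕ) < k → ∃ i : Fin n, w i = j

/-- The polynomial `∑ t^{n - 1 - des(w)}` over the words `w` of length `n` with letters in `[n]`
that contain each of the `k` smallest letters. -/
noncomputable def wordPolynomial (n k : ℕ) : Polynomial ℝ :=
  ∑ w ∈ coveringWords n k, Polynomial.X ^ (n - 1 - wordDes w)

/-- All complex roots of the real polynomial `p` are real. -/
def HasOnlyRealRoots (p : Polynomial ℝ) : Prop :=
  ∀ z : ℂ, Polynomial.aeval z p = 0 → z.im = 0

/-!
Write `M = m + 1` and `E(M) = ∑_{s ≤ k} (-1)^s C(k, s) C(M (n - s), n)`.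

**The identity.** Inclusion-exclusion over the set of those among the first `k` coordinates that
exceed `m` gives `#(m Q_{n,k} ∩ ℕⁿ) = E(m + 1)`, since subtracting `m + 1` from `s` coordinates
leaves the lattice points of a simplex (`ncard_natPoints_smul_octopusPolytope`). On the other side,
`n - 1 - des(w)` is the number of weak ascents of `w`, and Worpitzky's identity for words says that
`∑_m C((m + 1) a, n) t^m` has numerator `∑_w t^{wasc(w)}` over the words of length `n` on `a`
letters (`sum_X_pow_weakAscents`). It is proved together with a refinement by the first letter,
for which removing that letter gives a recursion (`ascentSeries_eq`). Inclusion-exclusion over the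
set of missing letters produces the same alternating sum (`coe_wordPolynomial`).

**Real-rootedness.** It rests on the fact that, as a polynomial in `M`, `E` has only real roots, all
in `[0, 1]` (`exists_multiset_shiftedEhrhart`). Up to a factor, `E(M)` is the `k`-th backward
difference with step `M` of `∏_{i < n} (Y - i)`, evaluated at `Y = n M`. For `0 ≤ M ≤ 1` the roots
of that product are at least `M` apart, and by a discrete form of Rolle's theorem this property
passes to differences with step `M`; so the `k`-th difference is
`M^k ∏_{i < n - k} (Y - y_i(M))` up to a constant, where the `y_i` are continuous on `[0, 1]`
and `0 ≤ y_i ≤ i + k` (`exists_continuous_roots_fwdDiff`). The line `Y = n M` lies weakly below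
each of these `n - k` curves at `M = 0` and above it at `M = 1`, hence meets each of them; together
with the factor `M^k` this accounts for all `n` roots of `E`.

Finally, multiplying the coefficients of a generating function `h / (1 - t)^{d+1}` by `m + 1 - c`
with `0 ≤ c ≤ 1` replaces `h` by `worpitzkyStep d c h`, and this operation keeps all roots real and
nonpositive: divided by `h`, the new numerator is a sum of fractions with nonnegative imaginary
part on the upper half-plane (`aeval_worpitzkyStep_ne_zero`). Applying this to the `n` linear
factors of `E` gives the claim.
-/

/-! ### Inclusion-exclusion -/

/-- Inclusion-exclusion for the elements of `U` with none of the properties `p i`, when the sum over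
the elements with all properties in `T` depends only on the size of `T`. -/
theorem Finset.sum_filter_forall_not_eq_alternating {ι α R : Type*} [CommRing R]
    (U : Finset α) (s : Finset ι) (p : ι → α → Prop) [∀ i x, Decidable (p i x)]
    (f : α → R) (g : ℕ → R)
    (hg : ∀ T ⊆ s, ∑ x ∈ U with ∀ i ∈ T, p i x, f x = g T.card) :
    ∑ x ∈ U with ∀ i ∈ s, ¬ p i x, f x =
      ∑ j ∈ Finset.range (s.card + 1), (-1) ^ j * (s.card.choose j : R) * g j := by
  classical
  have key : ∀ x, (if ∀ i ∈ s, ¬ p i x then f x else 0) =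
      ∑ T ∈ s.powerset, (-1) ^ T.card * (if ∀ i ∈ T, p i x then f x else 0) := by
    intro x
    have h1 : (if ∀ i ∈ s, ¬ p i x then f x else 0) =
        (∏ i ∈ s, (1 - (if p i x then (1 : R) else 0))) * f x := by
      split_ifs with h
      · rw [Finset.prod_eq_one, one_mul]
        intro i hi
        simp [h i hi]
      · push Not at h
        obtain ⟨i, hi, hp⟩ := h
        rw [Finset.prod_eq_zero hi (by simp [hp]), zero_mul]
    rw [h1, Finset.prod_sub, Finset.sum_mul]
    refine Finset.sum_congr rfl fun T hT => ?_
    rw [Finset.prod_const_one, mul_one, mul_assoc]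
    congr 1
    split_ifs with h
    · rw [Finset.prod_eq_one, one_mul]
      intro i hi
      simp [h i hi]
    · push Not at h
      obtain ⟨i, hi, hp⟩ := h
      rw [Finset.prod_eq_zero hi (by simp [hp]), zero_mul]
  rw [Finset.sum_filter, Finset.sum_congr rfl fun x _ => key x, Finset.sum_comm]
  have h2 : ∀ T ∈ s.powerset, ∑ x ∈ U, (-1) ^ T.card * (if ∀ i ∈ T, p i x then f x else 0) =
      (-1) ^ T.card * g T.card := by
    intro T hT
    rw [← hg T (Finset.mem_powerset.1 hT), Finset.sum_filter, Finset.mul_sum]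
  rw [Finset.sum_congr rfl h2, Finset.sum_powerset_apply_card (fun j => (-1) ^ j * g j)]
  refine Finset.sum_congr rfl fun j _ => ?_
  rw [nsmul_eq_mul]
  ring

/-! ### Lattice points of the dilated polytope -/

/-- The lattice points of the simplex `x_i ≥ 0`, `∑ x_i ≤ B` in `ℕⁿ`. -/
def simplexPoints (n B : ℕ) : Finset (Fin n → ℕ) :=
  (Fintype.piFinset fun _ => Finset.range (B + 1)).filter fun x => ∑ i, x i ≤ B

theorem mem_simplexPoints {n B : ℕ} {x : Fin n → ℕ} :
    x ∈ simplexPoints n B ↔ ∑ i, x i ≤ B := by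
  simp only [simplexPoints, Finset.mem_filter, Fintype.mem_piFinset, Finset.mem_range,
    Nat.lt_succ_iff, and_iff_right_iff_imp]
  exact fun h i => (Finset.single_le_sum (fun j _ => Nat.zero_le (x j)) (Finset.mem_univ i)).trans h

theorem card_simplexPoints (n B : ℕ) : (simplexPoints n B).card = (B + n).choose n := by
  have h := Finset.card_finsuppAntidiag_nat_eq_choose (s := (Finset.univ : Finset (Fin (n + 1)))) B
  rw [Finset.card_fin, Nat.add_right_comm, Nat.add_sub_cancel, Nat.add_comm n B] at h
  rw [Nat.choose_symm_add.symm, ← h]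
  refine Finset.card_bij'
    (fun x _ => Finsupp.equivFunOnFinite.symm (Fin.cons (B - ∑ i, x i) x : Fin (n + 1) → ℕ))
    (fun g _ => Fin.tail g) ?_ ?_ ?_ ?_
  · intro x hx
    rw [mem_simplexPoints] at hx
    simp [Finset.mem_finsuppAntidiag, Fin.sum_univ_succ, Nat.sub_add_cancel hx]
  · intro g hg
    rw [Finset.mem_finsuppAntidiag, Fin.sum_univ_succ] at hg
    rw [mem_simplexPoints]
    simp only [Fin.tail]
    omega
  · intro x hx
    simp
  · intro g hg
    rw [Finset.mem_finsuppAntidiag, Fin.sum_univ_succ] at hg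
    ext i
    refine Fin.cases ?_ (fun j => ?_) i
    · simp only [Finsupp.equivFunOnFinite_symm_apply_apply, Fin.cons_zero, Fin.tail]
      omega
    · simp [Fin.tail]

/-- Subtracting `m + 1` from the coordinates in `T` identifies the points of the dilated simplex
`∑ x_i ≤ mn` whose coordinates in `T` exceed `m` with the points of a smaller simplex. -/
theorem card_simplexPoints_filter (n m : ℕ) (T : Finset (Fin n)) :
    ((simplexPoints n (m * n)).filter fun x => ∀ i ∈ T, m < x i).card =
      ((m + 1) * (n - T.card)).choose n := by
  have hT : T.card ≤ n := by simpa using T.card_le_univ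
  have hind : ∑ i, (if i ∈ T then m + 1 else 0) = T.card * (m + 1) := by
    simp
  have hle : ∀ x : Fin n → ℕ, (∀ i ∈ T, m < x i) → ∀ i, (if i ∈ T then m + 1 else 0) ≤ x i := by
    intro x hx i
    split_ifs with h
    · exact hx i h
    · exact Nat.zero_le _
  have hmul : (m + 1) * (n - T.card) = m * n + n - T.card * (m + 1) := by
    rw [Nat.mul_sub, mul_comm _ T.card]
    congr 1
    ring
  by_cases hB : T.card * (m + 1) ≤ m * n
  · -- here `(m + 1) (n - #T) = B + n` with `B = m n - #T (m + 1)`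
    rw [hmul, Nat.sub_add_comm hB, ← card_simplexPoints]
    refine Finset.card_bij' (fun x _ i => x i - if i ∈ T then m + 1 else 0)
      (fun y _ i => y i + if i ∈ T then m + 1 else 0) ?_ ?_ ?_ ?_
    · intro x hx
      rw [Finset.mem_filter, mem_simplexPoints] at hx
      rw [mem_simplexPoints, Finset.sum_tsub_distrib _ fun i _ => hle x hx.2 i, hind]
      omega
    · intro y hy
      rw [mem_simplexPoints] at hy
      rw [Finset.mem_filter, mem_simplexPoints, Finset.sum_add_distrib, hind]
      refine ⟨by omega, fun i hi => ?_⟩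
      simp only [hi, if_true]
      omega
    · intro x hx
      rw [Finset.mem_filter] at hx
      funext i
      exact Nat.sub_add_cancel (hle x hx.2 i)
    · intro y _
      funext i
      exact Nat.add_sub_cancel _ _
  · -- no point is left, and the binomial coefficient vanishes as well
    have hpos : 0 < T.card := by
      by_contra h0
      exact hB (by rw [Nat.eq_zero_of_not_pos h0, zero_mul]; exact Nat.zero_le _)
    rw [Nat.choose_eq_zero_of_lt (by rw [hmul]; omega), Finset.card_eq_zero,
      Finset.filter_eq_empty_iff]
    intro x hx h
    rw [mem_simplexPoints] at hx
    have := Finset.sum_le_sum fun i (_ : i ∈ Finset.univ) => hle x h i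
    omega

theorem mem_smul_octopusPolytope {n k m : ℕ} {x : Fin n → ℝ} :
    x ∈ (m : ℝ) • octopusPolytope n k ↔
      (∀ i, 0 ≤ x i) ∧ (∀ i : Fin n, (i : ℕ) < k → x i ≤ m) ∧ ∑ i, x i ≤ (m * n : ℝ) := by
  rcases Nat.eq_zero_or_pos m with rfl | hm
  · -- `0 • Q = {0}`, and the inequalities also leave only the origin
    have h0 : (0 : Fin n → ℝ) ∈ octopusPolytope n k := by simp [octopusPolytope]
    rw [Nat.cast_zero, Set.zero_smul_set ⟨0, h0⟩, Set.mem_zero]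
    constructor
    · rintro rfl
      simp
    · rintro ⟨h1, -, h2⟩
      rw [zero_mul] at h2
      have h3 := (Finset.sum_eq_zero_iff_of_nonneg fun i _ => h1 i).1
        (le_antisymm h2 (Finset.sum_nonneg fun i _ => h1 i))
      exact funext fun i => h3 i (Finset.mem_univ i)
  · have hm' : (0 : ℝ) < m := Nat.cast_pos.2 hm
    rw [Set.mem_smul_set_iff_inv_smul_mem₀ hm'.ne']
    simp only [octopusPolytope, Set.mem_ofPred_eq, Pi.smul_apply, smul_eq_mul, ← Finset.mul_sum]
    refine and_congr (forall_congr' fun i => ?_) (and_congr (forall₂_congr fun i _ => ?_) ?_)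
    · exact mul_nonneg_iff_of_pos_left (inv_pos.2 hm')
    · rw [inv_mul_le_iff₀ hm', mul_one]
    · rw [inv_mul_le_iff₀ hm']

/-- The coordinates of index less than `k`, that is, those bounded by `1` in `Q_{n,k}`. -/
def firstIndices (n k : ℕ) : Finset (Fin n) := Finset.univ.filter fun i => (i : ℕ) < k

theorem card_firstIndices {n k : ℕ} (hk : k ≤ n) : (firstIndices n k).card = k := by
  rw [firstIndices, Fin.card_filter_val_lt, min_eq_right hk]

/-- The number of lattice points of `m • Q_{n,k}`, by inclusion-exclusion over the set of those
among the first `k` coordinates that exceed `m`. -/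
theorem ncard_natPoints_smul_octopusPolytope {n k : ℕ} (hk : k ≤ n) (m : ℕ) :
    ((natPoints ((m : ℝ) • octopusPolytope n k)).ncard : ℝ) =
      ∑ s ∈ Finset.range (k + 1),
        (-1) ^ s * (k.choose s : ℝ) * (((m + 1) * (n - s)).choose n : ℝ) := by
  have h := Finset.sum_filter_forall_not_eq_alternating (R := ℝ) (simplexPoints n (m * n))
    (firstIndices n k) (fun i x => m < x i) (fun _ => 1)
    (fun s => (((m + 1) * (n - s)).choose n : ℝ)) (fun T _ => by
      rw [← card_simplexPoints_filter, Finset.sum_const, nsmul_one]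
      congr!)
  rw [card_firstIndices hk] at h
  rw [← h, Finset.sum_const, nsmul_one, ← Set.ncard_coe_finset]
  congr 2
  ext x
  simp only [natPoints, Set.mem_ofPred_eq, mem_smul_octopusPolytope, Finset.coe_filter,
    mem_simplexPoints, firstIndices, Finset.mem_filter, Finset.mem_univ, true_and, not_lt,
    Nat.cast_le, Nat.cast_nonneg, implies_true]
  rw [and_comm]
  norm_cast

theorem polytopeDim_octopusPolytope {n k : ℕ} (hn : 1 ≤ n) :
    polytopeDim (octopusPolytope n k) = n := by
  have h0 : (0 : Fin n → ℝ) ∈ octopusPolytope n k := by simp [octopusPolytope]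
  have htop : vectorSpan ℝ (octopusPolytope n k) = ⊤ := by
    rw [eq_top_iff, ← (Pi.basisFun ℝ (Fin n)).span_eq, Submodule.span_le]
    rintro _ ⟨i, rfl⟩
    have h1 : (Pi.single i 1 : Fin n → ℝ) ∈ octopusPolytope n k := by
      refine ⟨fun j => ?_, fun j _ => ?_, ?_⟩
      · rw [Pi.single_apply]; split_ifs <;> norm_num
      · rw [Pi.single_apply]; split_ifs <;> norm_num
      · rw [Finset.sum_pi_single', if_pos (Finset.mem_univ i)]
        exact_mod_cast hn
    have h2 := vsub_mem_vectorSpan ℝ h1 h0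
    rw [vsub_eq_sub, sub_zero] at h2
    simpa using h2
  rw [polytopeDim, htop, finrank_top, Module.finrank_fin_fun]

/-! ### Words and weak ascents -/

/-- The number of positions `i` with `w_i ≤ w_{i+1}` in a nonempty word of natural numbers. -/
def weakAscents {l : ℕ} (w : Fin (l + 1) → ℕ) : ℕ :=
  (Finset.univ.filter fun i : Fin l => w i.castSucc ≤ w i.succ).card

theorem weakAscents_cons {l : ℕ} (c : ℕ) (w : Fin (l + 1) → ℕ) :
    weakAscents (Fin.cons c w : Fin (l + 2) → ℕ) =
      (if c ≤ w 0 then 1 else 0) + weakAscents w := by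
  simp only [weakAscents, Finset.card_filter, Fin.sum_univ_succ (n := l)]
  simp

theorem weakAscents_add_wordDes {l : ℕ} (w : Fin (l + 1) → Fin (l + 1)) :
    weakAscents (fun i => (w i : ℕ)) + wordDes w = l := by
  have h : wordDes w =
      (Finset.univ.filter fun i : Fin l => ¬ (w i.castSucc : ℕ) ≤ w i.succ).card := by
    rw [wordDes, Finset.card_filter, Finset.card_filter, Fin.sum_univ_castSucc]
    simp only [Fin.val_last, lt_self_iff_false, IsEmpty.exists_iff, if_false, add_zero, not_le]
    refine Finset.sum_congr rfl fun i _ => ?_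
    refine if_congr ?_ rfl rfl
    exact ⟨fun ⟨_, h⟩ => h, fun h => ⟨Nat.succ_lt_succ i.2, h⟩⟩
  rw [h, weakAscents, Finset.card_filter_add_card_filter_not, Finset.card_fin]

theorem weakAscents_comp_strictMono {l a : ℕ} {φ : Fin a → ℕ} (hφ : StrictMono φ)
    (w : Fin (l + 1) → Fin a) :
    weakAscents (fun i => φ (w i)) = weakAscents fun i => (w i : ℕ) := by
  simp only [weakAscents, hφ.le_iff_le, Fin.le_def]

theorem sum_range_choose_add_choose_succ (N c r : ℕ) :
    (∑ j ∈ Finset.range c, (N + j).choose r) + N.choose (r + 1) = (N + c).choose (r + 1) := by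
  induction c with
  | zero => simp
  | succ c ih =>
    rw [Finset.sum_range_succ, add_right_comm, ih, ← add_assoc, Nat.choose_succ_succ, add_comm]

/-- The generating function, by number of weak ascents, of the words of length `l + 1` whose first
letter is `c` and whose other letters are less than `a`. The value `c = a` is allowed: such a first
letter produces no weak ascent, so the sum is then over all words of length `l`. -/
noncomputable def ascentSeries (a l c : ℕ) : PowerSeries ℝ :=
  ∑ w : Fin l → Fin a,
    PowerSeries.X ^ weakAscents (Fin.cons c (fun i => (w i : ℕ)) : Fin (l + 1) → ℕ)

theorem ascentSeries_succ (a l c : ℕ) :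
    ascentSeries a (l + 1) c =
      ∑ j : Fin a, (if c ≤ j then PowerSeries.X else 1) * ascentSeries a l j := by
  rw [ascentSeries, ← (Fin.consEquiv fun _ : Fin (l + 1) => Fin a).sum_comp,
    Fintype.sum_prod_type]
  refine Finset.sum_congr rfl fun j _ => ?_
  rw [ascentSeries, Finset.mul_sum]
  refine Finset.sum_congr rfl fun w _ => ?_
  have h : (fun i => (((Fin.consEquiv fun _ : Fin (l + 1) => Fin a) (j, w)) i : ℕ)) =
      (Fin.cons (j : ℕ) (fun i => (w i : ℕ)) : Fin (l + 1) → ℕ) := by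
    funext i
    refine Fin.cases ?_ (fun i => ?_) i <;> simp [Fin.consEquiv]
  rw [h, weakAscents_cons, pow_add, Fin.cons_zero]
  split_ifs <;> simp

/-- A refinement of Worpitzky's identity by the first letter. In the inductive step, for `m ≥ 1`, the
coefficient of `t^m` on the right of the recursion is a sum of `C(x, l)` over the `a` consecutive
integers `x` from `(m - 1) a + c` on, which telescopes. -/
theorem ascentSeries_eq (a l : ℕ) : ∀ c ≤ a, ascentSeries a l c =
    (1 - PowerSeries.X) ^ (l + 1) *
      PowerSeries.mk fun m => (((m * a + c).choose l : ℕ) : ℝ) := by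
  induction l with
  | zero =>
    intro c _
    have h : (PowerSeries.mk fun m => (((m * a + c).choose 0 : ℕ) : ℝ)) =
        PowerSeries.mk 1 := by
      ext m; simp
    rw [h, zero_add, pow_one, mul_comm, PowerSeries.mk_one_mul_one_sub_eq_one]
    simp [ascentSeries, weakAscents]
  | succ l ih =>
    intro c hc
    rw [ascentSeries_succ, pow_succ, mul_assoc]
    have h1 : ∀ j : Fin a, (if c ≤ (j : ℕ) then PowerSeries.X else 1) * ascentSeries a l j =
        (1 - PowerSeries.X) ^ (l + 1) * ((if c ≤ (j : ℕ) then PowerSeries.X else 1) *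
          PowerSeries.mk fun m => (((m * a + j).choose l : ℕ) : ℝ)) := by
      intro j
      rw [ih j j.2.le]
      ring
    rw [Finset.sum_congr rfl fun j _ => h1 j, ← Finset.mul_sum]
    congr 1
    ext m
    rw [map_sum, sub_mul, one_mul, map_sub, PowerSeries.coeff_mk,
      Fin.sum_univ_eq_sum_range (fun j => PowerSeries.coeff m
        ((if c ≤ j then (PowerSeries.X : PowerSeries ℝ) else 1) *
          PowerSeries.mk fun m => (((m * a + j).choose l : ℕ) : ℝ))) a,
      ← Finset.sum_range_add_sum_Ico _ hc]
    have h2 : ∑ j ∈ Finset.range c, PowerSeries.coeff m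
        ((if c ≤ j then (PowerSeries.X : PowerSeries ℝ) else 1) *
          PowerSeries.mk fun m => (((m * a + j).choose l : ℕ) : ℝ)) =
        ((∑ j ∈ Finset.range c, (m * a + j).choose l : ℕ) : ℝ) := by
      rw [Nat.cast_sum]
      refine Finset.sum_congr rfl fun j hj => ?_
      rw [if_neg (not_le.2 (Finset.mem_range.1 hj)), one_mul, PowerSeries.coeff_mk]
    rw [h2]
    cases m with
    | zero =>
      have h3 : ∑ j ∈ Finset.Ico c a, PowerSeries.coeff 0
          ((if c ≤ j then (PowerSeries.X : PowerSeries ℝ) else 1) *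
            PowerSeries.mk fun m => (((m * a + j).choose l : ℕ) : ℝ)) = 0 := by
        refine Finset.sum_eq_zero fun j hj => ?_
        rw [if_pos (Finset.mem_Ico.1 hj).1, PowerSeries.coeff_zero_X_mul]
      rw [h3, PowerSeries.coeff_zero_X_mul, ← sum_range_choose_add_choose_succ]
      simp
    | succ m =>
      have h3 : ∑ j ∈ Finset.Ico c a, PowerSeries.coeff (m + 1)
          ((if c ≤ j then (PowerSeries.X : PowerSeries ℝ) else 1) *
            PowerSeries.mk fun m => (((m * a + j).choose l : ℕ) : ℝ)) =
          ((∑ j ∈ Finset.Ico c a, (m * a + j).choose l : ℕ) : ℝ) := by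
        rw [Nat.cast_sum]
        refine Finset.sum_congr rfl fun j hj => ?_
        rw [if_pos (Finset.mem_Ico.1 hj).1, PowerSeries.coeff_succ_X_mul, PowerSeries.coeff_mk]
      rw [h3, PowerSeries.coeff_succ_X_mul, PowerSeries.coeff_mk, eq_sub_iff_add_eq]
      norm_cast
      have e1 := sum_range_choose_add_choose_succ (m * a) c l
      have e2 := sum_range_choose_add_choose_succ (m * a) a l
      have e3 := sum_range_choose_add_choose_succ ((m + 1) * a) c l
      rw [← Finset.sum_range_add_sum_Ico _ hc] at e2
      have e4 : m * a + a = (m + 1) * a := by ring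
      rw [e4] at e2
      omega

/-- Worpitzky's identity for words of length `l + 1` over an alphabet of `a` letters. -/
theorem sum_X_pow_weakAscents (a l : ℕ) :
    (∑ w : Fin (l + 1) → Fin a, (PowerSeries.X : PowerSeries ℝ) ^ weakAscents fun i => (w i : ℕ)) =
      (1 - PowerSeries.X) ^ (l + 2) *
        PowerSeries.mk fun m => ((((m + 1) * a).choose (l + 1) : ℕ) : ℝ) := by
  have h := ascentSeries_eq a (l + 1) a le_rfl
  simp only [← Nat.succ_mul, Nat.succ_eq_add_one] at h
  rw [← h, ascentSeries]
  refine Finset.sum_congr rfl fun w _ => ?_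
  rw [weakAscents_cons, if_neg (not_le.2 (w 0).2), zero_add]

/-- The letters outside `T` form an alphabet of `l + 1 - #T` letters, and weak ascents depend only on
the order of the letters. -/
theorem sum_X_pow_weakAscents_avoiding {l : ℕ} (T : Finset (Fin (l + 1))) :
    (∑ w : Fin (l + 1) → Fin (l + 1) with ∀ j ∈ T, ¬ ∃ i, w i = j,
        (PowerSeries.X : PowerSeries ℝ) ^ weakAscents fun i => (w i : ℕ)) =
      (1 - PowerSeries.X) ^ (l + 2) * PowerSeries.mk fun m =>
        ((((m + 1) * (l + 1 - T.card)).choose (l + 1) : ℕ) : ℝ) := by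
  rw [← sum_X_pow_weakAscents]
  have hc : Tᶜ.card = l + 1 - T.card := by rw [Finset.card_compl, Fintype.card_fin]
  symm
  refine Finset.sum_bij (fun w _ i => Tᶜ.orderEmbOfFin hc (w i)) ?_ ?_ ?_ ?_
  · intro w _
    rw [Finset.mem_filter]
    refine ⟨Finset.mem_univ _, ?_⟩
    rintro j hj ⟨i, rfl⟩
    exact Finset.mem_compl.1 (Finset.orderEmbOfFin_mem Tᶜ hc (w i)) hj
  · intro w _ w' _ h
    funext i
    exact (Tᶜ.orderEmbOfFin hc).injective (congrFun h i)
  · intro v hv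
    rw [Finset.mem_filter] at hv
    have h : ∀ i, ∃ x, Tᶜ.orderEmbOfFin hc x = v i := by
      intro i
      have : v i ∈ Set.range (Tᶜ.orderEmbOfFin hc) := by
        rw [Finset.range_orderEmbOfFin, Finset.mem_coe, Finset.mem_compl]
        exact fun hi => hv.2 _ hi ⟨i, rfl⟩
      exact this
    choose w hw using h
    exact ⟨w, Finset.mem_univ _, funext hw⟩
  · intro w _
    rw [← weakAscents_comp_strictMono
      (φ := fun x => (Tᶜ.orderEmbOfFin hc x : ℕ))
      (fun x y h => (Tᶜ.orderEmbOfFin hc).strictMono h)]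

/-- The `h^*`-identity for the word polynomial, by inclusion-exclusion over the set of missing
letters. -/
theorem coe_wordPolynomial {n k : ℕ} (hn : 1 ≤ n) (hk : k ≤ n) :
    (wordPolynomial n k : PowerSeries ℝ) =
      (1 - PowerSeries.X) ^ (n + 1) * PowerSeries.mk fun m =>
        ∑ s ∈ Finset.range (k + 1),
          (-1) ^ s * (k.choose s : ℝ) * (((m + 1) * (n - s)).choose n : ℝ) := by
  classical
  obtain ⟨l, rfl⟩ := Nat.exists_eq_add_of_le' hn
  have h := Finset.sum_filter_forall_not_eq_alternating (R := PowerSeries ℝ)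
    (Finset.univ : Finset (Fin (l + 1) → Fin (l + 1))) (firstIndices (l + 1) k)
    (fun j w => ¬ ∃ i, w i = j) (fun w => PowerSeries.X ^ weakAscents fun i => (w i : ℕ))
    (fun s => (1 - PowerSeries.X) ^ (l + 2) * PowerSeries.mk fun m =>
      ((((m + 1) * (l + 1 - s)).choose (l + 1) : ℕ) : ℝ))
    (fun T _ => by
      rw [← sum_X_pow_weakAscents_avoiding T]
      congr!)
  rw [card_firstIndices hk] at h
  have h1 : (wordPolynomial (l + 1) k : PowerSeries ℝ) =
      ∑ w ∈ coveringWords (l + 1) k, PowerSeries.X ^ weakAscents fun i => (w i : ℕ) := by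
    rw [wordPolynomial, ← Polynomial.coeToPowerSeries.ringHom_apply, map_sum]
    refine Finset.sum_congr rfl fun w _ => ?_
    rw [map_pow, Polynomial.coeToPowerSeries.ringHom_apply, Polynomial.coe_X]
    congr 1
    have := weakAscents_add_wordDes w
    omega
  rw [h1]
  refine (Finset.sum_congr ?_ fun _ _ => rfl).trans (h.trans ?_)
  · ext w
    simp [coveringWords, firstIndices]
  simp only [mul_left_comm _ ((1 - PowerSeries.X : PowerSeries ℝ) ^ (l + 1 + 1)), ← Finset.mul_sum]
  congr 2
  ext m
  rw [PowerSeries.coeff_mk, map_sum]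
  refine Finset.sum_congr rfl fun s _ => ?_
  have h3 : ((-1 : PowerSeries ℝ) ^ s * (k.choose s : PowerSeries ℝ)) =
      PowerSeries.C ((-1 : ℝ) ^ s * (k.choose s : ℝ)) := by
    simp
  rw [h3, PowerSeries.coeff_C_mul, PowerSeries.coeff_mk]

/-! ### Numerators of generating functions and their roots -/

/-- `h` is a nonzero real polynomial of degree at most `d` whose complex roots are real and
nonpositive. -/
def IsNonposRooted (d : ℕ) (h : Polynomial ℝ) : Prop :=
  h ≠ 0 ∧ h.natDegree ≤ d ∧ ∀ z : ℂ, Polynomial.aeval z h = 0 → z.im = 0 ∧ z.re ≤ 0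

/-- If `h / (1 - t)^{d+1}` is the generating function of `f(m)`, then
`worpitzkyStep d c h / (1 - t)^{d+2}` is the generating function of `(m + 1 - c) f(m)`. -/
noncomputable def worpitzkyStep (d : ℕ) (c : ℝ) (h : Polynomial ℝ) : Polynomial ℝ :=
  (1 - Polynomial.X) * Polynomial.X * Polynomial.derivative h +
    (Polynomial.C (1 - c) + Polynomial.C (d + c) * Polynomial.X) * h

theorem mk_mul_one_sub_X_pow_worpitzkyStep {d : ℕ} {c : ℝ} {h : Polynomial ℝ} {f : ℕ → ℝ}
    (hf : PowerSeries.mk f * (1 - PowerSeries.X) ^ (d + 1) = (h : PowerSeries ℝ)) :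
    PowerSeries.mk (fun m : ℕ => ((m : ℝ) + 1 - c) * f m) * (1 - PowerSeries.X) ^ (d + 2) =
      (worpitzkyStep d c h : PowerSeries ℝ) := by
  have h1 : PowerSeries.mk (fun m : ℕ => ((m : ℝ) + 1 - c) * f m) =
      PowerSeries.C (1 - c) * PowerSeries.mk f +
        PowerSeries.X * PowerSeries.derivative ℝ (PowerSeries.mk f) := by
    ext m
    cases m with
    | zero => simp
    | succ m =>
      rw [map_add, PowerSeries.coeff_succ_X_mul, PowerSeries.coeff_C_mul,
        PowerSeries.coeff_derivative, PowerSeries.coeff_mk, PowerSeries.coeff_mk]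
      push_cast
      ring
  have h2 := congrArg (PowerSeries.derivative ℝ) hf
  rw [Derivation.leibniz, Derivation.leibniz_pow, map_sub, PowerSeries.derivative_X,
    PowerSeries.derivative_coe] at h2
  have h3 : PowerSeries.derivative ℝ (1 : PowerSeries ℝ) = 0 := by
    simp
  rw [h3] at h2
  simp only [smul_eq_mul, nsmul_eq_mul, Nat.add_sub_cancel, zero_sub] at h2
  have h4 : ((worpitzkyStep d c h : Polynomial ℝ) : PowerSeries ℝ) =
      (1 - PowerSeries.X) * PowerSeries.X * (Polynomial.derivative h : PowerSeries ℝ) +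
        (PowerSeries.C (1 - c) + PowerSeries.C ((d : ℝ) + c) * PowerSeries.X) *
          (h : PowerSeries ℝ) := by
    simp only [worpitzkyStep, Polynomial.coe_add, Polynomial.coe_mul, Polynomial.coe_sub,
      Polynomial.coe_one, Polynomial.coe_X, Polynomial.coe_C]
  rw [h1, h4, ← h2, ← hf]
  simp only [map_add, map_sub, map_natCast, map_one]
  push_cast
  ring

theorem Polynomial.aeval_conj_eq_zero {p : Polynomial ℝ} {z : ℂ}
    (hz : Polynomial.aeval z p = 0) : Polynomial.aeval (starRingEnd ℂ z) p = 0 := by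
  rw [Polynomial.aeval_conj, hz, map_zero]

/-- Rewrites `(1 - z) z h'(z) / h(z)`, where `s` is the multiset of roots of `h`, as a sum of terms
whose imaginary parts have a constant sign on the upper half-plane when the roots are nonpositive. -/
theorem sum_one_div_sub_eq (z : ℂ) (s : Multiset ℂ) (hs : ∀ ρ ∈ s, z - ρ ≠ 0) :
    (1 - z) * z * (s.map fun ρ => 1 / (z - ρ)).sum =
      (s.map fun ρ => (1 - ρ) * (z / (z - ρ))).sum - s.card * z := by
  induction s using Multiset.induction_on with
  | empty => simp
  | cons ρ s ih =>
    have h := hs ρ (Multiset.mem_cons_self ρ s)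
    simp only [Multiset.map_cons, Multiset.sum_cons, Multiset.card_cons, mul_add,
      ih fun σ hσ => hs σ (Multiset.mem_cons_of_mem hσ)]
    push_cast
    field_simp
    ring

theorem im_one_sub_mul_div_sub {z ρ : ℂ} (hρ : ρ.im = 0) :
    ((1 - ρ) * (z / (z - ρ))).im = (1 - ρ.re) * -ρ.re * z.im / Complex.normSq (z - ρ) := by
  have h1 : ρ = (ρ.re : ℂ) := Complex.ext rfl (by simp [hρ])
  rw [h1]
  simp only [Complex.mul_im, Complex.div_im, Complex.div_re, Complex.sub_re, Complex.sub_im,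
    Complex.one_re, Complex.one_im, Complex.ofReal_re, Complex.ofReal_im]
  ring

/-- In the open upper half-plane, a sum of the fractions `(1 - ρ) z / (z - ρ)` with `ρ ≤ 0` has
nonnegative imaginary part, and that imaginary part is zero only if every `ρ` is zero. -/
theorem sum_one_sub_mul_div_sub_im {z : ℂ} (hz : 0 < z.im) (s : Multiset ℂ)
    (hs : ∀ ρ ∈ s, ρ.im = 0 ∧ ρ.re ≤ 0) :
    0 ≤ (s.map fun ρ => (1 - ρ) * (z / (z - ρ))).sum.im ∧
      ((s.map fun ρ => (1 - ρ) * (z / (z - ρ))).sum.im = 0 →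
        (s.map fun ρ => (1 - ρ) * (z / (z - ρ))).sum = s.card) := by
  have hz0 : z ≠ 0 := fun h => by simp [h] at hz
  induction s using Multiset.induction_on with
  | empty => simp
  | cons ρ s ih =>
    obtain ⟨h1, h2⟩ := ih fun σ hσ => hs σ (Multiset.mem_cons_of_mem hσ)
    obtain ⟨hi, hr⟩ := hs ρ (Multiset.mem_cons_self ρ s)
    have hne : z - ρ ≠ 0 := fun h => by
      have := congrArg Complex.im h
      simp only [Complex.sub_im, hi, Complex.zero_im] at this
      linarith
    have hN : 0 < Complex.normSq (z - ρ) := Complex.normSq_pos.2 hne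
    have h3 : 0 ≤ ((1 - ρ) * (z / (z - ρ))).im := by
      rw [im_one_sub_mul_div_sub hi]
      have : 0 ≤ (1 - ρ.re) * -ρ.re := mul_nonneg (by linarith) (by linarith)
      positivity
    rw [Multiset.map_cons, Multiset.sum_cons, Complex.add_im]
    refine ⟨add_nonneg h3 h1, fun h => ?_⟩
    have h4 : ((1 - ρ) * (z / (z - ρ))).im = 0 := by linarith
    rw [h2 (by linarith), Multiset.card_cons]
    rw [im_one_sub_mul_div_sub hi, div_eq_zero_iff, or_iff_left hN.ne', mul_eq_zero,
      or_iff_left hz.ne', mul_eq_zero] at h4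
    have h5 : ρ.re = 0 := by rcases h4 with h4 | h4 <;> linarith
    have h6 : ρ = 0 := Complex.ext h5 hi
    rw [h6, sub_zero, sub_zero, div_self hz0]
    push_cast
    ring

theorem sum_one_sub_mul_div_sub_re {z : ℂ} (hz : z.im = 0) (hz' : 0 < z.re) (s : Multiset ℂ)
    (hs : ∀ ρ ∈ s, ρ.im = 0 ∧ ρ.re ≤ 0) :
    0 ≤ (s.map fun ρ => (1 - ρ) * (z / (z - ρ))).sum.re := by
  induction s using Multiset.induction_on with
  | empty => simp
  | cons ρ s ih =>
    obtain ⟨hi, hr⟩ := hs ρ (Multiset.mem_cons_self ρ s)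
    rw [Multiset.map_cons, Multiset.sum_cons, Complex.add_re]
    refine add_nonneg ?_ (ih fun σ hσ => hs σ (Multiset.mem_cons_of_mem hσ))
    have h1 : ρ = (ρ.re : ℂ) := Complex.ext rfl (by simp [hi])
    have h2 : z = (z.re : ℂ) := Complex.ext rfl (by simp [hz])
    rw [h1, h2]
    norm_cast
    exact mul_nonneg (by linarith) (div_nonneg hz'.le (by linarith))

/-- The polynomial `worpitzkyStep d c h` has no zeros in the open upper half-plane or on the positive
real axis. -/
theorem aeval_worpitzkyStep_ne_zero {d : ℕ} {c : ℝ} {h : Polynomial ℝ} (hc0 : 0 ≤ c) (hc1 : c ≤ 1)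
    (hh : IsNonposRooted d h) {z : ℂ} (hz : 0 < z.im ∨ z.im = 0 ∧ 0 < z.re) :
    Polynomial.aeval z (worpitzkyStep d c h) ≠ 0 := by
  obtain ⟨h0, hd, hroots⟩ := hh
  set p : Polynomial ℂ := h.map (algebraMap ℝ ℂ) with hp
  have hev : ∀ w, p.eval w = Polynomial.aeval w h := fun w => by
    rw [hp, Polynomial.eval_map_algebraMap]
  have hp0 : p ≠ 0 := (Polynomial.map_ne_zero_iff (algebraMap ℝ ℂ).injective).2 h0
  have hs : ∀ ρ ∈ p.roots, ρ.im = 0 ∧ ρ.re ≤ 0 := fun ρ hρ =>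
    hroots ρ (by rw [← hev]; exact (Polynomial.mem_roots hp0).1 hρ)
  have hpz : p.eval z ≠ 0 := fun h => by
    obtain ⟨h1, h2⟩ := hroots z (by rw [← hev, h])
    rcases hz with hz | hz
    · exact hz.ne' h1
    · linarith [hz.2]
  have hder := (IsAlgClosed.splits p).eval_derivative_eq_eval_mul_sum hpz
  have hsub : ∀ ρ ∈ p.roots, z - ρ ≠ 0 := fun ρ hρ h => by
    rw [sub_eq_zero.1 h] at hpz
    exact hpz ((Polynomial.mem_roots hp0).1 hρ)
  have hsum := sum_one_div_sub_eq z p.roots hsub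
  have hcard : p.roots.card = h.natDegree := by
    rw [← (IsAlgClosed.splits p).natDegree_eq_card_roots, hp, Polynomial.natDegree_map]
  set S := (p.roots.map fun ρ => (1 - ρ) * (z / (z - ρ))).sum with hS
  -- the value of the step at `z` is the value of `h` times a sum of fractions
  have hval : Polynomial.aeval z (worpitzkyStep d c h) =
      p.eval z * (S + ((1 - c : ℝ) : ℂ) + ((d - h.natDegree + c : ℝ) : ℂ) * z) := by
    have e1 : Polynomial.aeval z (Polynomial.derivative h) = (Polynomial.derivative p).eval z := by
      rw [hp, Polynomial.derivative_map, Polynomial.eval_map_algebraMap]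
    rw [worpitzkyStep]
    simp only [map_add, map_mul, map_sub, map_one, Polynomial.aeval_X, Polynomial.aeval_C, e1,
      ← hev, hder, Complex.coe_algebraMap]
    rw [hcard] at hsum
    push_cast
    linear_combination p.eval z * hsum
  rw [hval]
  refine mul_ne_zero hpz fun hzero => ?_
  have hd' : (0 : ℝ) ≤ d - h.natDegree := sub_nonneg.2 (Nat.cast_le.2 hd)
  rcases hz with hz | ⟨hz, hz'⟩
  · -- all imaginary parts are nonnegative; if they vanish, the sum is `#roots + 1`
    obtain ⟨i1, i2⟩ := sum_one_sub_mul_div_sub_im hz p.roots hs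
    have him := congrArg Complex.im hzero
    simp only [Complex.add_im, Complex.mul_im, Complex.ofReal_re, Complex.ofReal_im, zero_mul,
      add_zero, Complex.zero_im] at him
    have hnn : 0 ≤ (d - h.natDegree + c : ℝ) * z.im := mul_nonneg (by linarith) hz.le
    have h1 : (d - h.natDegree + c : ℝ) = 0 := by
      rcases mul_eq_zero.1 (show (d - h.natDegree + c : ℝ) * z.im = 0 by linarith) with h | h
      · exact h
      · exact absurd h hz.ne'
    have hc : c = 0 := by linarith
    rw [h1, hS, i2 (by linarith), hc] at hzero
    have hre := congrArg Complex.re hzero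
    simp only [Complex.add_re, Complex.natCast_re, Complex.ofReal_re, Complex.ofReal_zero,
      zero_mul, Complex.zero_re, add_zero, sub_zero] at hre
    have : (0 : ℝ) ≤ p.roots.card := Nat.cast_nonneg _
    linarith
  · have i1 := sum_one_sub_mul_div_sub_re hz hz' p.roots hs
    have hre := congrArg Complex.re hzero
    simp only [Complex.add_re, Complex.mul_re, Complex.ofReal_re, Complex.ofReal_im, zero_mul,
      sub_zero, Complex.zero_re] at hre
    have h1 : 0 ≤ (d - h.natDegree : ℝ) * z.re := mul_nonneg hd' hz'.le
    have h2 : 0 ≤ c * z.re := mul_nonneg hc0 hz'.le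
    have hc : c = 1 := by linarith
    rw [hc] at h2 hre
    linarith

theorem IsNonposRooted.worpitzkyStep {d : ℕ} {c : ℝ} {h : Polynomial ℝ} (hc0 : 0 ≤ c) (hc1 : c ≤ 1)
    (hh : IsNonposRooted d h) : IsNonposRooted (d + 1) (worpitzkyStep d c h) := by
  refine ⟨fun h0 => ?_, ?_, fun z hz => ?_⟩
  · refine aeval_worpitzkyStep_ne_zero hc0 hc1 hh (z := 1) (Or.inr (by simp)) ?_
    rw [h0, map_zero]
  · rw [_root_.worpitzkyStep]
    have hd := hh.2.1
    have e1 : ((1 - Polynomial.X : Polynomial ℝ) * Polynomial.X).natDegree ≤ 2 := by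
      compute_degree
    have e2 : (Polynomial.C (1 - c) + Polynomial.C (d + c) * Polynomial.X).natDegree ≤ 1 := by
      compute_degree
    refine (Polynomial.natDegree_add_le _ _).trans (max_le ?_ ?_)
    · rcases Nat.eq_zero_or_pos h.natDegree with h0 | h0
      · rw [Polynomial.derivative_of_natDegree_zero h0, mul_zero, Polynomial.natDegree_zero]
        exact Nat.zero_le _
      · have e3 := Polynomial.natDegree_derivative_le h
        have e4 := Polynomial.natDegree_mul_le (p := (1 - Polynomial.X) * Polynomial.X)
          (q := Polynomial.derivative h)
        omega
    · have e4 := Polynomial.natDegree_mul_le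
        (p := Polynomial.C (1 - c) + Polynomial.C (d + c) * Polynomial.X) (q := h)
      omega
  · by_contra hcon
    by_cases him : z.im = 0
    · have hre : 0 < z.re := by
        by_contra h1
        exact hcon ⟨him, not_lt.1 h1⟩
      exact aeval_worpitzkyStep_ne_zero hc0 hc1 hh (Or.inr ⟨him, hre⟩) hz
    · rcases lt_or_gt_of_ne him with h1 | h1
      · exact aeval_worpitzkyStep_ne_zero hc0 hc1 hh (z := starRingEnd ℂ z)
          (Or.inl (by simpa using h1)) (Polynomial.aeval_conj_eq_zero hz)
      · exact aeval_worpitzkyStep_ne_zero hc0 hc1 hh (Or.inl h1) hz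

/-- If a polynomial in `m + 1` has all its roots in `[0, 1]`, then the numerator of its generating
function has only real nonpositive roots. -/
theorem exists_isNonposRooted_numerator {a : ℝ} (ha : a ≠ 0) (s : Multiset ℝ)
    (hs : ∀ c ∈ s, 0 ≤ c ∧ c ≤ 1) :
    ∃ h : Polynomial ℝ, IsNonposRooted s.card h ∧
      PowerSeries.mk (fun m : ℕ => a * (s.map fun c => ((m : ℝ) + 1 - c)).prod) *
        (1 - PowerSeries.X) ^ (s.card + 1) = (h : PowerSeries ℝ) := by
  induction s using Multiset.induction_on with
  | empty =>
    refine ⟨Polynomial.C a, ⟨Polynomial.C_ne_zero.2 ha, by simp, fun z hz => ?_⟩, ?_⟩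
    · rw [Polynomial.aeval_C] at hz
      exact absurd ((map_eq_zero _).1 hz) ha
    · have h : PowerSeries.mk (fun m : ℕ =>
          a * ((0 : Multiset ℝ).map fun c => ((m : ℝ) + 1 - c)).prod) =
          PowerSeries.C a * PowerSeries.mk 1 := by
        ext m; simp
      rw [h, Multiset.card_zero, zero_add, pow_one, mul_assoc,
        PowerSeries.mk_one_mul_one_sub_eq_one, mul_one, Polynomial.coe_C]
  | cons c s ih =>
    obtain ⟨h, hh, hf⟩ := ih fun c hc => hs c (Multiset.mem_cons_of_mem hc)
    obtain ⟨hc0, hc1⟩ := hs c (Multiset.mem_cons_self c s)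
    refine ⟨worpitzkyStep s.card c h, ?_, ?_⟩
    · rw [Multiset.card_cons]
      exact hh.worpitzkyStep hc0 hc1
    · rw [Multiset.card_cons, ← mk_mul_one_sub_X_pow_worpitzkyStep hf]
      congr 2
      funext m
      rw [Multiset.map_cons, Multiset.prod_cons]
      ring

/-! ### Roots of differences of real-rooted polynomials -/

theorem Polynomial.eq_C_mul_prod_X_sub_C {p : Polynomial ℝ} {d : ℕ} {y : ℕ → ℝ}
    (hp : p.natDegree ≤ d) (hy : Set.InjOn y (Finset.range d))
    (hroot : ∀ i < d, p.eval (y i) = 0) :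
    p = Polynomial.C (p.coeff d) * ∏ i ∈ Finset.range d, (Polynomial.X - Polynomial.C (y i)) := by
  classical
  have hm : (∏ i ∈ Finset.range d, (Polynomial.X - Polynomial.C (y i))).Monic :=
    Polynomial.monic_prod_of_monic _ _ fun i _ => Polynomial.monic_X_sub_C _
  have hdeg : (∏ i ∈ Finset.range d, (Polynomial.X - Polynomial.C (y i))).natDegree = d := by
    rw [Polynomial.natDegree_prod_of_monic _ _ fun i _ => Polynomial.monic_X_sub_C _]
    simp only [Polynomial.natDegree_X_sub_C, Finset.sum_const, Finset.card_range, smul_eq_mul,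
      mul_one]
  refine Polynomial.eq_of_degree_sub_lt_of_eval_finset_eq ((Finset.range d).image y) ?_ ?_
  · rw [Finset.card_image_of_injOn hy, Finset.card_range, Polynomial.degree_lt_iff_coeff_zero]
    intro j hj
    rw [Polynomial.coeff_sub, Polynomial.coeff_C_mul]
    rcases hj.eq_or_lt with rfl | hj
    · have := hm.coeff_natDegree
      rw [hdeg] at this
      rw [this, mul_one, sub_self]
    · have h1 : p.coeff j = 0 := Polynomial.coeff_eq_zero_of_natDegree_lt (by omega)
      have h2 := Polynomial.coeff_eq_zero_of_natDegree_lt (hdeg.trans_lt hj)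
      rw [h1, h2, mul_zero, sub_zero]
  · intro z hz
    obtain ⟨i, hi, rfl⟩ := Finset.mem_image.1 hz
    rw [hroot i (Finset.mem_range.1 hi), Polynomial.eval_mul, Polynomial.eval_prod,
      Finset.prod_eq_zero hi (by simp), mul_zero]

/-- The divided backward difference `(F(Y) - F(Y - M)) / M` of `F(Y) = ∏_{j < d} (Y - x_j)`,
in a form that makes sense also for `M = 0`, where it is the derivative of `F`. -/
noncomputable def dividedDiff (x : ℕ → ℝ) (M : ℝ) : ℕ → Polynomial ℝ
  | 0 => 0
  | d + 1 => dividedDiff x M d * (Polynomial.X - Polynomial.C (x d)) +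
      ∏ j ∈ Finset.range d, (Polynomial.X - Polynomial.C (M + x j))

theorem mul_eval_dividedDiff (x : ℕ → ℝ) (M Y : ℝ) (d : ℕ) :
    M * (dividedDiff x M d).eval Y =
      ∏ j ∈ Finset.range d, (Y - x j) - ∏ j ∈ Finset.range d, (Y - M - x j) := by
  induction d with
  | zero => simp [dividedDiff]
  | succ d ih =>
    rw [dividedDiff, Polynomial.eval_add, Polynomial.eval_mul, Polynomial.eval_prod, mul_add,
      ← mul_assoc, ih, Finset.prod_range_succ, Finset.prod_range_succ]
    simp only [Polynomial.eval_sub, Polynomial.eval_X, Polynomial.eval_C, ← sub_sub]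
    ring

theorem eval_dividedDiff_add (x : ℕ → ℝ) (M : ℝ) {d i : ℕ} (hi : i < d) :
    (dividedDiff x M d).eval (x i + M) =
      ∏ j ∈ (Finset.range d).erase i, (x i + M - x j) := by
  induction d with
  | zero => omega
  | succ d ih =>
    rw [dividedDiff, Polynomial.eval_add, Polynomial.eval_mul, Polynomial.eval_prod,
      Finset.range_add_one]
    simp only [Polynomial.eval_sub, Polynomial.eval_X, Polynomial.eval_C]
    rcases Nat.lt_succ_iff_lt_or_eq.1 hi with h | rfl
    · rw [Finset.erase_insert_of_ne h.ne', Finset.prod_insert (by simp), ih h,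
        Finset.prod_eq_zero (Finset.mem_range.2 h) (by ring), add_zero, mul_comm]
    · rw [Finset.erase_insert (by simp), add_sub_cancel_left, mul_comm, mul_eval_dividedDiff]
      simp only [add_sub_cancel_right, add_comm M, ← sub_sub, sub_right_comm _ _ M]
      ring

theorem eval_dividedDiff_self (x : ℕ → ℝ) (M : ℝ) {d i : ℕ} (hi : i < d) :
    (dividedDiff x M d).eval (x i) = ∏ j ∈ (Finset.range d).erase i, (x i - M - x j) := by
  induction d with
  | zero => omega
  | succ d ih =>
    rw [dividedDiff, Polynomial.eval_add, Polynomial.eval_mul, Polynomial.eval_prod,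
      Finset.range_add_one]
    simp only [Polynomial.eval_sub, Polynomial.eval_X, Polynomial.eval_C, ← sub_sub]
    rcases Nat.lt_succ_iff_lt_or_eq.1 hi with h | rfl
    · rw [Finset.erase_insert_of_ne h.ne', Finset.prod_insert (by simp), ih h,
        ← Finset.mul_prod_erase _ _ (Finset.mem_range.2 h)]
      ring
    · rw [Finset.erase_insert (by simp), sub_self, mul_zero, zero_add]

theorem natDegree_dividedDiff_le (x : ℕ → ℝ) (M : ℝ) (d : ℕ) :
    (dividedDiff x M (d + 1)).natDegree ≤ d ∧ (dividedDiff x M (d + 1)).coeff d = d + 1 := by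
  have hm : ∀ d, (∏ j ∈ Finset.range d, (Polynomial.X - Polynomial.C (M + x j))).Monic :=
    fun d => Polynomial.monic_prod_of_monic _ _ fun i _ => Polynomial.monic_X_sub_C _
  have hdeg : ∀ d, (∏ j ∈ Finset.range d,
      (Polynomial.X - Polynomial.C (M + x j))).natDegree = d := by
    intro d
    rw [Polynomial.natDegree_prod_of_monic _ _ fun i _ => Polynomial.monic_X_sub_C _]
    simp only [Polynomial.natDegree_X_sub_C, Finset.sum_const, Finset.card_range, smul_eq_mul,
      mul_one]
  induction d with
  | zero => simp [dividedDiff]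
  | succ d ih =>
    rw [dividedDiff]
    refine ⟨(Polynomial.natDegree_add_le _ _).trans (max_le ?_ (hdeg _).le), ?_⟩
    · refine Polynomial.natDegree_mul_le.trans ?_
      rw [Polynomial.natDegree_X_sub_C]
      exact Nat.add_le_add_right ih.1 1
    · have h1 := (hm (d + 1)).coeff_natDegree
      rw [hdeg] at h1
      rw [Polynomial.coeff_add, h1, mul_sub, Polynomial.coeff_sub, Polynomial.coeff_mul_X, ih.2,
        Polynomial.coeff_mul_C, Polynomial.coeff_eq_zero_of_natDegree_lt (by omega)]
      push_cast
      ring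

theorem continuous_eval_dividedDiff {X : Type*} [TopologicalSpace X] {x : ℕ → X → ℝ}
    (hx : ∀ i, Continuous (x i)) {M Y : X → ℝ} (hM : Continuous M) (hY : Continuous Y) (d : ℕ) :
    Continuous fun t => (dividedDiff (fun i => x i t) (M t) d).eval (Y t) := by
  induction d with
  | zero => simpa [dividedDiff] using continuous_const
  | succ d ih =>
    simp only [dividedDiff, Polynomial.eval_add, Polynomial.eval_mul, Polynomial.eval_prod,
      Polynomial.eval_sub, Polynomial.eval_X, Polynomial.eval_C]
    exact (ih.mul (hY.sub (hx d))).add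
      (continuous_finsetProd _ fun j _ => hY.sub (hM.add (hx j)))

/-- The sign of a product whose factors change sign once, at the omitted index `i`. -/
theorem neg_one_pow_mul_prod_erase_nonneg {t : ℕ → ℝ} {d i : ℕ} (hi : i ≤ d)
    (h1 : ∀ j < i, 0 ≤ t j) (h2 : ∀ j, i < j → j ≤ d → t j ≤ 0) :
    0 ≤ (-1) ^ (d - i) * ∏ j ∈ (Finset.range (d + 1)).erase i, t j := by
  have h3 : (Finset.range (d + 1)).erase i = Finset.range i ∪ Finset.Ico (i + 1) (d + 1) := by
    ext j
    simp only [Finset.mem_erase, Finset.mem_range, Finset.mem_union, Finset.mem_Ico]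
    omega
  have h4 : Disjoint (Finset.range i) (Finset.Ico (i + 1) (d + 1)) := by
    rw [Finset.disjoint_left]
    intro j hj
    simp only [Finset.mem_range, Finset.mem_Ico] at hj ⊢
    omega
  have h5 : ∏ j ∈ Finset.Ico (i + 1) (d + 1), -t j =
      (-1) ^ (d - i) * ∏ j ∈ Finset.Ico (i + 1) (d + 1), t j := by
    rw [Finset.prod_neg, Nat.card_Ico]
    congr 2
    omega
  rw [h3, Finset.prod_union h4, mul_left_comm, ← h5]
  refine mul_nonneg (Finset.prod_nonneg fun j hj => h1 j (Finset.mem_range.1 hj))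
    (Finset.prod_nonneg fun j hj => ?_)
  rw [Finset.mem_Ico] at hj
  linarith [h2 j (by omega) (by omega)]

theorem add_le_of_gaps {x : ℕ → ℝ} {M : ℝ} (hM : 0 ≤ M) {d : ℕ}
    (hgap : ∀ i, i + 1 ≤ d → x i + M ≤ x (i + 1)) {i j : ℕ} (hij : i < j) (hj : j ≤ d) :
    x i + M ≤ x j := by
  induction j, hij using Nat.le_induction with
  | base => exact hgap i hj
  | succ j hij ih =>
    have := hgap j hj
    linarith [ih (by omega)]

theorem lt_of_gaps {x : ℕ → ℝ} {d : ℕ} (hlt : ∀ i, i + 1 ≤ d → x i < x (i + 1)) {i j : ℕ}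
    (hij : i < j) (hj : j ≤ d) : x i < x j := by
  induction j, hij using Nat.le_induction with
  | base => exact hlt i hj
  | succ j hij ih => exact (ih (by omega)).trans (hlt j hj)

/-- Discrete Rolle theorem: if consecutive roots `x_0 < ⋯ < x_d` are at least `M` apart, the
divided difference with step `M` has a zero between `x_i + M` and `x_{i+1}`. -/
theorem exists_eval_dividedDiff_eq_zero {x : ℕ → ℝ} {M : ℝ} (hM : 0 ≤ M) {d : ℕ}
    (hgap : ∀ i, i + 1 ≤ d → x i + M ≤ x (i + 1)) {i : ℕ} (hi : i < d) :
    ∃ y ∈ Set.Icc (x i + M) (x (i + 1)), (dividedDiff x M (d + 1)).eval y = 0 := by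
  have hle : x i + M ≤ x (i + 1) := hgap i hi
  have h1 : 0 ≤ (-1) ^ (d - i) * (dividedDiff x M (d + 1)).eval (x i + M) := by
    rw [eval_dividedDiff_add x M (by omega)]
    refine neg_one_pow_mul_prod_erase_nonneg hi.le (fun j hj => ?_) fun j hj hj' => ?_
    · linarith [add_le_of_gaps hM hgap hj hi.le]
    · linarith [add_le_of_gaps hM hgap hj hj']
  have h2 : 0 ≤ (-1) ^ (d - (i + 1)) * (dividedDiff x M (d + 1)).eval (x (i + 1)) := by
    rw [eval_dividedDiff_self x M (by omega)]
    refine neg_one_pow_mul_prod_erase_nonneg hi (fun j hj => ?_) fun j hj hj' => ?_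
    · linarith [add_le_of_gaps hM hgap hj hi]
    · linarith [add_le_of_gaps hM hgap hj hj']
  have h3 : (-1 : ℝ) ^ (d - i) = -(-1) ^ (d - (i + 1)) := by
    rw [show d - i = d - (i + 1) + 1 by omega, pow_succ]
    ring
  have hcont : ContinuousOn
      (fun y => (-1) ^ (d - (i + 1)) * (dividedDiff x M (d + 1)).eval y)
      (Set.Icc (x i + M) (x (i + 1))) :=
    (continuous_const.mul (Polynomial.continuous _)).continuousOn
  obtain ⟨y, hy, hy0⟩ := intermediate_value_Icc hle hcont
    (show (0 : ℝ) ∈ Set.Icc _ _ from ⟨by rw [h3] at h1; linarith, h2⟩)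
  exact ⟨y, hy, (mul_eq_zero.1 hy0).resolve_left (pow_ne_zero _ (by norm_num))⟩

section RootFamily

variable {x y : ℕ → ℝ} {M : ℝ} {d : ℕ}

/-- The zeros supplied by the discrete Rolle theorem are distinct. For `M > 0` they are at least `M`
apart; for `M = 0` they would otherwise meet at a simple root of `∏ (Y - x_j)`, where the derivative
does not vanish. -/
theorem dividedDiff_roots_lt (hM : 0 ≤ M) (hlt : ∀ i, i + 1 ≤ d → x i < x (i + 1))
    (hy : ∀ i < d, y i ∈ Set.Icc (x i + M) (x (i + 1)))
    (hy0 : ∀ i < d, (dividedDiff x M (d + 1)).eval (y i) = 0) {i : ℕ} (hi : i + 1 < d) :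
    y i < y (i + 1) := by
  have h1 := (hy i (by omega)).2
  have h2 := (hy (i + 1) hi).1
  rcases hM.eq_or_lt with rfl | hM
  · refine lt_of_le_of_ne (by linarith) fun h => ?_
    have h3 : y i = x (i + 1) := by linarith
    have h4 := hy0 i (by omega)
    rw [h3, eval_dividedDiff_self x 0 (by omega), Finset.prod_eq_zero_iff] at h4
    obtain ⟨j, hj, h5⟩ := h4
    rw [Finset.mem_erase, Finset.mem_range] at hj
    rcases lt_or_gt_of_ne hj.1 with h | h
    · linarith [lt_of_gaps hlt h (by omega)]
    · linarith [lt_of_gaps hlt h (by omega)]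
  · linarith

theorem dividedDiff_eq_C_mul_prod (hM : 0 ≤ M) (hlt : ∀ i, i + 1 ≤ d → x i < x (i + 1))
    (hy : ∀ i < d, y i ∈ Set.Icc (x i + M) (x (i + 1)))
    (hy0 : ∀ i < d, (dividedDiff x M (d + 1)).eval (y i) = 0) :
    dividedDiff x M (d + 1) =
      Polynomial.C ((d : ℝ) + 1) * ∏ i ∈ Finset.range d, (Polynomial.X - Polynomial.C (y i)) := by
  obtain ⟨h1, h2⟩ := natDegree_dividedDiff_le x M d
  have h3 : ∀ i j, i < j → j < d → y i < y j := by
    intro i j hij hj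
    refine lt_of_gaps (d := d - 1) (fun i hi => ?_) hij (by omega)
    exact dividedDiff_roots_lt hM hlt hy hy0 (by omega)
  rw [← h2]
  refine Polynomial.eq_C_mul_prod_X_sub_C h1 (fun i hi j hj hij => ?_) hy0
  rw [Finset.coe_range, Set.mem_Iio] at hi hj
  rcases lt_trichotomy i j with h | h | h
  · exact absurd hij (h3 i j h hj).ne
  · exact h
  · exact absurd hij (h3 j i h hi).ne'

theorem dividedDiff_root_unique (hM : 0 ≤ M) (hlt : ∀ i, i + 1 ≤ d → x i < x (i + 1))
    (hy : ∀ i < d, y i ∈ Set.Icc (x i + M) (x (i + 1)))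
    (hy0 : ∀ i < d, (dividedDiff x M (d + 1)).eval (y i) = 0) {i : ℕ} (hi : i < d) {z : ℝ}
    (hz : z ∈ Set.Icc (x i + M) (x (i + 1))) (hz0 : (dividedDiff x M (d + 1)).eval z = 0) :
    z = y i := by
  -- the family with `y i` replaced by `z` is strictly increasing as well
  have hy' : ∀ j < d, Function.update y i z j ∈ Set.Icc (x j + M) (x (j + 1)) := by
    intro j hj
    rcases eq_or_ne j i with rfl | h
    · rwa [Function.update_self]
    · rw [Function.update_of_ne h]; exact hy j hj
  have hy0' : ∀ j < d, (dividedDiff x M (d + 1)).eval (Function.update y i z j) = 0 := by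
    intro j hj
    rcases eq_or_ne j i with rfl | h
    · rwa [Function.update_self]
    · rw [Function.update_of_ne h]; exact hy0 j hj
  have hmono : ∀ j k, j < k → k < d → Function.update y i z j < Function.update y i z k := by
    intro j k hjk hk
    refine lt_of_gaps (d := d - 1) (fun i hi => ?_) hjk (by omega)
    exact dividedDiff_roots_lt hM hlt hy' hy0' (by omega)
  rw [dividedDiff_eq_C_mul_prod hM hlt hy hy0, Polynomial.eval_mul, Polynomial.eval_prod,
    Polynomial.eval_C, mul_eq_zero, or_iff_right (by positivity), Finset.prod_eq_zero_iff] at hz0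
  obtain ⟨j, hj, h⟩ := hz0
  rw [Finset.mem_range] at hj
  simp only [Polynomial.eval_sub, Polynomial.eval_X, Polynomial.eval_C] at h
  rcases lt_trichotomy j i with hji | rfl | hji
  · have := hmono j i hji hi
    rw [Function.update_self, Function.update_of_ne hji.ne] at this
    linarith
  · linarith
  · have := hmono i j hji hj
    rw [Function.update_self, Function.update_of_ne hji.ne'] at this
    linarith

end RootFamily

/-- A closed graph theorem: a bounded function that picks out the unique point of each fibre of a
closed set is continuous. -/
theorem continuous_of_isClosed_of_forall_unique {X : Type*} [TopologicalSpace X] {S : Set (X × ℝ)}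
    (hS : IsClosed S) {f : X → ℝ} {a b : ℝ} (hf : ∀ t, f t ∈ Set.Icc a b)
    (hmem : ∀ t, (t, f t) ∈ S) (huniq : ∀ t z, (t, z) ∈ S → z = f t) : Continuous f := by
  rw [continuous_iff_continuousAt]
  intro t
  refine isCompact_Icc.tendsto_nhds_of_unique_mapClusterPt (Filter.Eventually.of_forall hf) ?_
  intro z _ hz
  refine huniq t z ?_
  by_contra hn
  have h1 : ∀ᶠ p in nhds (t, z), p ∉ S := hS.isOpen_compl.mem_nhds hn
  rw [nhds_prod_eq] at h1
  obtain ⟨P, hP, Q, hQ, h2⟩ := Filter.eventually_prod_iff.1 h1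
  obtain ⟨u, hu1, hu2⟩ := ((mapClusterPt_iff_frequently.1 hz _ hQ).and_eventually hP).exists
  exact h2 hu2 hu1 (hmem u)

/-- For a step `M ∈ [0, 1]`, the `k`-th backward difference of `∏_{i < l} (Y - i)` has real roots
that depend continuously on `M`, are at least `M` apart, and satisfy `0 ≤ y_i ≤ i + k`. The
backward difference with step `M` is the forward difference with step `-M`, up to sign. -/
theorem exists_continuous_roots_fwdDiff (l : ℕ) : ∀ k ≤ l, ∃ y : ℕ → Set.Icc (0 : ℝ) 1 → ℝ,
    (∀ i, Continuous (y i)) ∧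
    (∀ M i, i + 1 < l - k → y i M + M ≤ y (i + 1) M) ∧
    (∀ M i, i + 1 < l - k → y i M < y (i + 1) M) ∧
    (∀ M i, i < l - k → 0 ≤ y i M ∧ y i M ≤ i + k) ∧
    ∀ (M : Set.Icc (0 : ℝ) 1) (Y : ℝ),
      (fwdDiff (-(M : ℝ)))^[k] (fun Y : ℝ => ∏ i ∈ Finset.range l, (Y - i)) Y =
        (-M : ℝ) ^ k * l.descFactorial k * ∏ i ∈ Finset.range (l - k), (Y - y i M) := by
  intro k
  induction k with
  | zero =>
    intro _
    refine ⟨fun i _ => i, fun i => continuous_const, fun M i _ => ?_, fun M i _ => ?_,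
      fun M i _ => ?_, fun M Y => by simp⟩
    · push_cast
      linarith [M.2.2]
    · push_cast
      linarith
    · simp
  | succ k ih =>
    intro hk
    obtain ⟨x, hcont, hgap, hlt, hbd, hprod⟩ := ih (by omega)
    obtain ⟨d, hd⟩ : ∃ d, l - k = d + 1 := ⟨l - k - 1, by omega⟩
    have hd' : l - (k + 1) = d := by omega
    rw [hd] at hgap hlt hbd hprod
    have hgap' : ∀ M : Set.Icc (0 : ℝ) 1, ∀ i, i + 1 ≤ d → x i M + M ≤ x (i + 1) M :=
      fun M i hi => hgap M i (by omega)
    have hlt' : ∀ M : Set.Icc (0 : ℝ) 1, ∀ i, i + 1 ≤ d → x i M < x (i + 1) M :=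
      fun M i hi => hlt M i (by omega)
    have hex : ∀ (i : ℕ) (M : Set.Icc (0 : ℝ) 1), ∃ z, (d ≤ i → z = 0) ∧
        (i < d → z ∈ Set.Icc (x i M + M) (x (i + 1) M) ∧
          (dividedDiff (fun j => x j M) M (d + 1)).eval z = 0) := by
      intro i M
      rcases lt_or_ge i d with hi | hi
      · obtain ⟨z, hz⟩ := exists_eval_dividedDiff_eq_zero (x := fun j => x j M) M.2.1 (hgap' M) hi
        exact ⟨z, fun h => absurd h (not_le.2 hi), fun _ => hz⟩
      · exact ⟨0, fun _ => rfl, fun h => absurd h (not_lt.2 hi)⟩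
    choose y hy1 hy2 using hex
    have hbd' : ∀ M i, i < d → 0 ≤ y i M ∧ y i M ≤ i + (k + 1 : ℕ) := by
      intro M i hi
      obtain ⟨h1, h2⟩ := (hy2 i M hi).1
      have h3 := (hbd M i (by omega)).1
      have h4 := (hbd M (i + 1) (by omega)).2
      push_cast at h4 ⊢
      exact ⟨by linarith [M.2.1], by linarith⟩
    rw [hd']
    refine ⟨y, fun i => ?_, fun M i hi => ?_, fun M i hi => ?_, hbd', fun M Y => ?_⟩
    · rcases lt_or_ge i d with hi | hi
      · -- `y i M` is the only zero in its interval, so continuity follows from a closed graph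
        have hS : IsClosed {p : Set.Icc (0 : ℝ) 1 × ℝ |
            (x i p.1 + p.1 ≤ p.2 ∧ p.2 ≤ x (i + 1) p.1) ∧
              (dividedDiff (fun j => x j p.1) p.1 (d + 1)).eval p.2 = 0} := by
          have c1 : ∀ j, Continuous fun p : Set.Icc (0 : ℝ) 1 × ℝ => x j p.1 :=
            fun j => (hcont j).comp continuous_fst
          have c2 : Continuous fun p : Set.Icc (0 : ℝ) 1 × ℝ => (p.1 : ℝ) :=
            continuous_subtype_val.comp continuous_fst
          refine ((isClosed_le ((c1 i).add c2) continuous_snd).inter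
            (isClosed_le continuous_snd (c1 (i + 1)))).inter (isClosed_eq ?_ continuous_const)
          exact continuous_eval_dividedDiff c1 c2 continuous_snd (d + 1)
        refine continuous_of_isClosed_of_forall_unique hS (fun M => hbd' M i hi)
          (fun M => hy2 i M hi) fun M z hz => ?_
        exact dividedDiff_root_unique (x := fun j => x j M) M.2.1 (hlt' M)
          (fun j hj => (hy2 j M hj).1) (fun j hj => (hy2 j M hj).2) hi hz.1 hz.2
      · rw [show y i = fun _ => 0 from funext fun M => hy1 i M hi]
        exact continuous_const
    · have h1 := (hy2 i M (by omega)).1.2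
      have h2 := (hy2 (i + 1) M (by omega)).1.1
      linarith
    · exact dividedDiff_roots_lt (x := fun j => x j M) (y := fun j => y j M) M.2.1 (hlt' M)
          (fun j hj => (hy2 j M hj).1) (fun j hj => (hy2 j M hj).2) hi
    · have h1 := mul_eval_dividedDiff (fun j => x j M) M Y (d + 1)
      rw [dividedDiff_eq_C_mul_prod (x := fun j => x j M) (y := fun j => y j M) M.2.1 (hlt' M)
        (fun j hj => (hy2 j M hj).1) (fun j hj => (hy2 j M hj).2)] at h1
      simp only [Polynomial.eval_mul, Polynomial.eval_C, Polynomial.eval_prod, Polynomial.eval_sub,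
        Polynomial.eval_X] at h1
      rw [Function.iterate_succ_apply', fwdDiff, hprod, hprod, ← sub_eq_add_neg,
        Nat.descFactorial_succ, hd, pow_succ]
      push_cast
      linear_combination (-M : ℝ) ^ k * l.descFactorial k * h1

/-! ### Roots of the shifted Ehrhart polynomial -/

/-- A polynomial that equals `M ^ k * g(M)` on `[0, 1]` with `g` continuous is divisible by `X ^ k`,
and the quotient equals `g` on all of `[0, 1]`. -/
theorem exists_eq_X_pow_mul {g : Set.Icc (0 : ℝ) 1 → ℝ} (hg : Continuous g) (k : ℕ) :
    ∀ {p : Polynomial ℝ}, (∀ M : Set.Icc (0 : ℝ) 1, p.eval (M : ℝ) = (M : ℝ) ^ k * g M) →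
      ∃ q : Polynomial ℝ, p = Polynomial.X ^ k * q ∧
        ∀ M : Set.Icc (0 : ℝ) 1, q.eval (M : ℝ) = g M := by
  induction k generalizing g with
  | zero => exact fun {p} hp => ⟨p, by simp, fun M => by simpa using hp M⟩
  | succ k ih =>
    intro p hp
    obtain ⟨q, rfl, hq⟩ := ih (g := fun M => (M : ℝ) * g M) (continuous_subtype_val.mul hg)
      (p := p) fun M => by rw [hp, pow_succ, mul_assoc]
    have h0 : q.eval 0 = 0 := by
      have := hq ⟨0, by simp⟩
      simpa using this
    obtain ⟨r, rfl⟩ := (Polynomial.X_dvd_iff (f := q)).2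
      (by rw [Polynomial.coeff_zero_eq_eval_zero, h0])
    refine ⟨r, by ring, ?_⟩
    have hcl : IsClosed {M : Set.Icc (0 : ℝ) 1 | r.eval (M : ℝ) = g M} :=
      isClosed_eq (r.continuous.comp continuous_subtype_val) hg
    have hdense : Dense ({⟨0, by simp⟩}ᶜ : Set (Set.Icc (0 : ℝ) 1)) := dense_compl_singleton _
    have hsub : ({⟨0, by simp⟩}ᶜ : Set (Set.Icc (0 : ℝ) 1)) ⊆
        {M : Set.Icc (0 : ℝ) 1 | r.eval (M : ℝ) = g M} := by
      intro M hM
      have hM0 : (M : ℝ) ≠ 0 := fun h => hM (Subtype.ext h)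
      have := hq M
      rw [Polynomial.eval_mul, Polynomial.eval_X] at this
      exact mul_left_cancel₀ hM0 this
    intro M
    have := hcl.closure_subset_iff.2 hsub
    rw [hdense.closure_eq] at this
    exact this (Set.mem_univ M)

/-- The polynomial in `M` that equals `n!` times the Ehrhart polynomial of `Q_{n,k}` at `M - 1`. -/
noncomputable def shiftedEhrhart (n k : ℕ) : Polynomial ℝ :=
  ∑ s ∈ Finset.range (k + 1), Polynomial.C ((-1) ^ s * (k.choose s : ℝ)) *
    ∏ i ∈ Finset.range n, (Polynomial.C ((n - s : ℕ) : ℝ) * Polynomial.X - Polynomial.C (i : ℝ))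

theorem eval_shiftedEhrhart (n k : ℕ) (M : ℝ) :
    (shiftedEhrhart n k).eval M = ∑ s ∈ Finset.range (k + 1), (-1) ^ s * (k.choose s : ℝ) *
      ∏ i ∈ Finset.range n, (((n - s : ℕ) : ℝ) * M - i) := by
  simp [shiftedEhrhart, Polynomial.eval_finsetSum, Polynomial.eval_prod]

theorem eval_shiftedEhrhart_natCast (n k m : ℕ) :
    (shiftedEhrhart n k).eval ((m : ℝ) + 1) = n.factorial * ∑ s ∈ Finset.range (k + 1),
      (-1) ^ s * (k.choose s : ℝ) * (((m + 1) * (n - s)).choose n : ℝ) := by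
  rw [eval_shiftedEhrhart, Finset.mul_sum]
  refine Finset.sum_congr rfl fun s _ => ?_
  have h := descPochhammer_eval_eq_descFactorial ℝ ((m + 1) * (n - s)) n
  rw [descPochhammer_eval_eq_prod_range, Nat.descFactorial_eq_factorial_mul_choose] at h
  push_cast at h
  rw [mul_comm ((n - s : ℕ) : ℝ), h]
  ring

theorem natDegree_shiftedEhrhart_le (n k : ℕ) : (shiftedEhrhart n k).natDegree ≤ n := by
  refine Polynomial.natDegree_sum_le_of_forall_le _ _ fun s _ => ?_
  refine Polynomial.natDegree_C_mul_le _ _ |>.trans ?_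
  refine (Polynomial.natDegree_prod_le _ _).trans ?_
  refine (Finset.sum_le_card_nsmul _ _ 1 fun i _ => ?_).trans (by simp)
  compute_degree

theorem eval_shiftedEhrhart_eq_fwdDiff {n k : ℕ} (hk : k ≤ n) (M : ℝ) :
    (shiftedEhrhart n k).eval M =
      (-1) ^ k * (fwdDiff (-M))^[k] (fun Y : ℝ => ∏ i ∈ Finset.range n, (Y - i)) (n * M) := by
  rw [eval_shiftedEhrhart, fwdDiff_iter_eq_sum_shift, Finset.mul_sum]
  refine Finset.sum_congr rfl fun s hs => ?_
  have hs' : s ≤ k := Nat.lt_succ_iff.1 (Finset.mem_range.1 hs)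
  have h1 : (n : ℝ) * M + s • -M = ((n - s : ℕ) : ℝ) * M := by
    rw [Nat.cast_sub (hs'.trans hk), nsmul_eq_mul]
    ring
  have h2 : (-1 : ℝ) ^ k * (-1) ^ (k - s) = (-1) ^ s := by
    rw [← pow_add, show k + (k - s) = s + 2 * (k - s) by omega, pow_add, pow_mul]
    simp
  rw [h1, zsmul_eq_mul]
  push_cast
  rw [← h2]
  ring

/-- All roots of `shiftedEhrhart n k` are real and lie in `[0, 1]`; `s` is the multiset of roots. -/
theorem exists_multiset_shiftedEhrhart {n k : ℕ} (hk : k ≤ n) :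
    ∃ (a : ℝ) (s : Multiset ℝ), a ≠ 0 ∧ s.card = n ∧ (∀ c ∈ s, 0 ≤ c ∧ c ≤ 1) ∧
      ∀ M : ℝ, (shiftedEhrhart n k).eval M = a * (s.map fun c => M - c).prod := by
  obtain ⟨y, hcont, -, hlt, hbd, hprod⟩ := exists_continuous_roots_fwdDiff n k hk
  set g : Set.Icc (0 : ℝ) 1 → ℝ := fun M =>
    n.descFactorial k * ∏ i ∈ Finset.range (n - k), ((n : ℝ) * M - y i M) with hg
  have hgc : Continuous g :=
    continuous_const.mul (continuous_finsetProd _ fun i _ =>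
      (continuous_const.mul continuous_subtype_val).sub (hcont i))
  obtain ⟨q, hq, hqg⟩ := exists_eq_X_pow_mul hgc k (p := shiftedEhrhart n k) fun M => by
    have h1 : (-1 : ℝ) ^ k * (-(M : ℝ)) ^ k = (M : ℝ) ^ k := by
      rw [← mul_pow]
      ring
    rw [eval_shiftedEhrhart_eq_fwdDiff hk, hprod, hg, ← h1]
    ring
  -- the line `Y = n M` meets each root curve `Y = y_i(M)` over `[0, 1]`
  have hcross : ∀ i, ∃ M : Set.Icc (0 : ℝ) 1, i < n - k → (n : ℝ) * M = y i M := by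
    intro i
    by_cases hi : i < n - k
    · have hc : Continuous fun M : Set.Icc (0 : ℝ) 1 => (n : ℝ) * M - y i M :=
        (continuous_const.mul continuous_subtype_val).sub (hcont i)
      have h0 : (n : ℝ) * ((⟨0, by simp⟩ : Set.Icc (0 : ℝ) 1) : ℝ) - y i ⟨0, by simp⟩ ≤ 0 := by
        have := (hbd ⟨0, by simp⟩ i hi).1
        simpa using this
      have h1 : 0 ≤ (n : ℝ) * ((⟨1, by simp⟩ : Set.Icc (0 : ℝ) 1) : ℝ) - y i ⟨1, by simp⟩ := by
        have h2 := (hbd ⟨1, by simp⟩ i hi).2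
        have h3 : ((i + k : ℕ) : ℝ) ≤ n := Nat.cast_le.2 (by omega)
        push_cast at h3
        rw [mul_one]
        linarith
      obtain ⟨M, hM⟩ := mem_range_of_exists_le_of_exists_ge hc ⟨_, h0⟩ ⟨_, h1⟩
      exact ⟨M, fun _ => sub_eq_zero.1 hM⟩
    · exact ⟨⟨0, by simp⟩, fun h => absurd h hi⟩
  choose r hr using hcross
  -- two root curves never meet, so the crossings are distinct
  have hinj : Set.InjOn (fun i => (r i : ℝ)) (Finset.range (n - k)) := by
    have h1 : ∀ i j, i < j → j < n - k → (r i : ℝ) ≠ r j := by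
      intro i j hij hj h
      have h2 := lt_of_gaps (x := fun i => y i (r j)) (d := n - k - 1)
        (fun i hi => hlt (r j) i (by omega)) hij (by omega)
      rw [← hr j hj, ← Subtype.ext h, ← hr i (hij.trans hj)] at h2
      exact lt_irrefl _ h2
    intro i hi j hj hij
    rw [Finset.coe_range, Set.mem_Iio] at hi hj
    rcases lt_trichotomy i j with h | h | h
    · exact absurd hij (h1 i j h hj)
    · exact h
    · exact absurd hij.symm (h1 j i h hi)
  have hroot : ∀ i < n - k, q.eval (r i : ℝ) = 0 := by
    intro i hi
    rw [hqg, hg]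
    simp only
    rw [Finset.prod_eq_zero (Finset.mem_range.2 hi) (sub_eq_zero.2 (hr i hi)), mul_zero]
  have hq1 : q.eval 1 ≠ 0 := by
    have h1 := hqg ⟨1, by simp⟩
    simp only at h1
    rw [h1, hg]
    refine mul_ne_zero (Nat.cast_ne_zero.2 (Nat.descFactorial_pos.2 hk).ne') ?_
    refine Finset.prod_ne_zero_iff.2 fun i hi => ?_
    have h2 := (hbd ⟨1, by simp⟩ i (Finset.mem_range.1 hi)).2
    have h3 : ((i + k : ℕ) : ℝ) < n := Nat.cast_lt.2 (by have := Finset.mem_range.1 hi; omega)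
    push_cast at h3
    simp only [mul_one]
    linarith
  have hq0 : q ≠ 0 := fun h => hq1 (by rw [h, Polynomial.eval_zero])
  have hdeg : q.natDegree ≤ n - k := by
    have h1 := natDegree_shiftedEhrhart_le n k
    rw [hq, Polynomial.natDegree_X_pow_mul k hq0] at h1
    omega
  have hfac := Polynomial.eq_C_mul_prod_X_sub_C hdeg hinj hroot
  have heval : ∀ M : ℝ, q.eval M = q.coeff (n - k) * ∏ i ∈ Finset.range (n - k), (M - r i) := by
    intro M
    conv_lhs => rw [hfac]
    simp [Polynomial.eval_prod]
  refine ⟨q.coeff (n - k), Multiset.replicate k 0 + (Multiset.range (n - k)).map fun i => (r i : ℝ),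
    fun h => hq1 (by rw [heval, h, zero_mul]), ?_, fun c hc => ?_, fun M => ?_⟩
  · rw [Multiset.card_add, Multiset.card_replicate, Multiset.card_map, Multiset.card_range]
    omega
  · rcases Multiset.mem_add.1 hc with hc | hc
    · rw [Multiset.eq_of_mem_replicate hc]
      norm_num
    · obtain ⟨i, -, rfl⟩ := Multiset.mem_map.1 hc
      exact (r i).2
  · rw [hq, Polynomial.eval_mul, heval, Polynomial.eval_pow, Polynomial.eval_X, Multiset.map_add,
      Multiset.prod_add, Multiset.map_replicate, Multiset.prod_replicate, Multiset.map_map, sub_zero]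
    have : ∏ i ∈ Finset.range (n - k), (M - (r i : ℝ)) =
        ((Multiset.range (n - k)).map ((fun c => M - c) ∘ fun i => (r i : ℝ))).prod := rfl
    rw [this]
    ring

/-! ### The `h^*`-polynomial and its roots -/

theorem theorem1p5 (n k : ℕ) (hn : 1 ≤ n) (hk : k ≤ n) :
    IsHStarPolynomial (octopusPolytope n k) (wordPolynomial n k) ∧
      HasOnlyRealRoots (wordPolynomial n k) := by
  have hfac : (n.factorial : ℝ) ≠ 0 := Nat.cast_ne_zero.2 n.factorial_ne_zero
  have hword := coe_wordPolynomial hn hk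
  constructor
  · have hE : ∀ m : ℕ, (Polynomial.C (n.factorial : ℝ)⁻¹ *
        (shiftedEhrhart n k).comp (Polynomial.X + 1)).eval (m : ℝ) =
        ∑ s ∈ Finset.range (k + 1),
          (-1) ^ s * (k.choose s : ℝ) * (((m + 1) * (n - s)).choose n : ℝ) := by
      intro m
      rw [Polynomial.eval_mul, Polynomial.eval_C, Polynomial.eval_comp, Polynomial.eval_add,
        Polynomial.eval_X, Polynomial.eval_one, eval_shiftedEhrhart_natCast,
        inv_mul_cancel_left₀ hfac]
    refine ⟨Polynomial.C (n.factorial : ℝ)⁻¹ *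
      (shiftedEhrhart n k).comp (Polynomial.X + 1), fun m => ?_, ?_⟩
    · rw [hE, ncard_natPoints_smul_octopusPolytope hk]
    · rw [polytopeDim_octopusPolytope hn, hword, mul_comm]
      simp only [hE]
  · obtain ⟨a, s, ha, hcard, hs, hprod⟩ := exists_multiset_shiftedEhrhart hk
    obtain ⟨h, hh, hser⟩ := exists_isNonposRooted_numerator
      (mul_ne_zero (inv_ne_zero hfac) ha) s hs
    have heq : wordPolynomial n k = h := by
      refine Polynomial.coe_injective ℝ ?_
      rw [hword, ← hser, hcard, mul_comm]
      congr 2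
      funext m
      rw [mul_assoc, ← hprod, eval_shiftedEhrhart_natCast, inv_mul_cancel_left₀ hfac]
    intro z hz
    rw [heq] at hz
    exact (hh.2.2 z hz).1
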